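/- Let $N\ge 1$ agents communicate over a connected undirected graph $\mathcal G$ on $\{1,\dots,N\}$; let $\mathcal N_i$ be the set of neighbours of $i$. Agent $i$ has a compact convex set $\Omega_i\subset\mathbb R^{n_i}$, a cost function $f_i$ and a constraint mapping $\mathbf g_i=(g_{i1},\dots,g_{iM})^T$ with values in $\mathbb R^M$; on an open convex set $U_i\supseteq\Omega_i$, $f_i$ is strictly convex, each $g_{ik}$ is convex, and $f_i$, $\mathbf g_i$ are locally Lipschitz continuous. Write $\mathbf x=\mathrm{col}(x_1,\dots,x_N)$, $\Omega=\prod_i\Omega_i$, $\boldsymbol\lambda=\mathrm{col}(\lambda_1,\dots,\lambda_N)$ with $\lambda_i\in\mathbb R^M$, and assume Slater's condition: there is a point $\bar{\mathbf x}$ in the relative interior of $\Omega$ with $\sum_i\mathbf g_i(\bar x_i)<\mathbf 0$ componentwise. Let $$\tilde{\mathcal L}(\mathbf x,\boldsymbol\lambda)=\sum_{i}\big(f_i(x_i)+\lambda_i^T\mathbf g_i(x_i)\big)-\frac K2\sum_i\sum_{j\in\mathcal N_i}|\lambda_i-\lambda_j|_1,$$ where the constant $K$ satisfies $K>\sqrt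 N\,K_0$ with $K_0=\max_{\mathbf x\in\Omega}\|\mathrm{col}(\mathbf g_1(x_1),\dots,\mathbf g_N(x_N))\|_2$. A saddle point of $\tilde{\mathcal L}$ is a point $(\mathbf x^*,\boldsymbol\lambda^*)\in\Omega\times\mathbb R^{MN}_+$ with $\tilde{\mathcal L}(\mathbf x^*,\boldsymbol\lambda)\le\tilde{\mathcal L}(\mathbf x^*,\boldsymbol\lambda^*)\le\tilde{\mathcal L}(\mathbf x,\boldsymbol\lambda^*)$ for all $\mathbf x\in\Omega$, $\boldsymbol\lambda\in\mathbb R^{MN}_+$. For a closed convex set $C$ and a set $A$ of vectors, let $\Pi_C(z;A)$ be the set of the Euclidean projections of the elements of $A$ onto the tangent cone of $C$ at $z$. Consider the algorithm $$\dot{\mathbf x}\in\Pi_\Omega\big(\mathbf x;-\partial_{\mathbf x}\tilde{\mathcal L}(\mathbf x,\boldsymbol\lambda)\big),\quad \dot{\boldsymbol\lambda}\in\Pi_{\mathbb R^{MN}_+}\big(\boldsymbol\lambda;-\partial_{\boldsymbol\lambda}(-\tilde{\mathcal L})(\mathbf x,\boldsymbol\lambda)\big),\quad \mathbf x(0)\in\Omega,\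 \boldsymbol\lambda(0)\in\mathbb R^{MN}_+,$$ where $\partial_{\mathbf x}$ and $\partial_{\boldsymbol\lambda}$ are the subdifferentials with respect to the whole vectors $\mathbf x\in\prod_i U_i$ and $\boldsymbol\lambda\in\mathbb R^{MN}$; its solutions are the locally absolutely continuous maps on $[0,\infty)$ that satisfy the inclusions for almost all $t$, and its equilibria are the points at which $0$ lies in both right-hand sides. Then the algorithm is stable: it has an equilibrium, and every equilibrium $z^*$ is Lyapunov stable (for every $\varepsilon>0$ there is $\delta>0$ such that every solution that starts at distance less than $\delta$ from $z^*$ stays at distance less than $\varepsilon$ from $z^*$ for all $t\ge 0$). The distance of any solution $(\mathbf x(t),\boldsymbol\lambda(t))$ to the set of saddle points of $\tilde{\mathcal L}$ tends to $0$ as $t\to+\infty$. Moreover, for any solution there is a saddle point $(\mathbf x^*,\tilde{\boldsymbol\lambda}^*)$ of $\tilde{\mathcal L}$ such that $\lim_{t\to+\infty}(\mathbf x(t),\boldsymbol\lambda(t))=(\mathbf x^*,\tilde{\boldsymbol\lambda}^*)$. -/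

import Mathlib

open Set Filter Topology MeasureTheory
open scoped Pointwise

noncomputable section

namespace DistOpt

/-- The space `ℝ^{n_1 + ⋯ + n_N}` of stacked decision variables `x = col(x_1, …, x_N)` with its
Euclidean norm; `x ⟨i, j⟩` is the `j`-th component of the decision variable `x_i`. -/
abbrev Primal {N : ℕ} (n : Fin N → ℕ) : Type := EuclideanSpace ℝ (Σ i : Fin N, Fin (n i))

/-- The space `ℝ^{MN}` of stacked local multipliers `col(λ_1, …, λ_N)` with its Euclidean norm;
`lam (i, k)` is the `k`-th component of the multiplier `λ_i`. -/
abbrev Dual (N M : ℕ) : Type := EuclideanSpace ℝ (Fin N × Fin M)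

/-- The decision variable `x_i` of agent `i`. -/
def block {N : ℕ} {n : Fin N → ℕ} (x : Primal n) (i : Fin N) : EuclideanSpace ℝ (Fin (n i)) :=
  WithLp.toLp 2 (fun j => x ⟨i, j⟩)

/-- The nonnegative orthant `ℝ^{MN}_+`. -/
def orthant (N M : ℕ) : Set (Dual N M) := {lam | ∀ i k, 0 ≤ lam (i, k)}

section ConvexAnalysis

variable {E : Type*} [NormedAddCommGroup E] [InnerProductSpace ℝ E]

/-- The subdifferential at `x` of a function `F` with domain `U`. For `F` convex on an open convex
set `U` this is a local notion: it does not depend on the choice of `U`, and it coincides with the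
generalized gradient of Clarke. -/
def subdifferential (U : Set E) (F : E → ℝ) (x : E) : Set E :=
  {v | x ∈ U ∧ ∀ y ∈ U, F x + inner ℝ v (y - x) ≤ F y}

/-- The set `P_C(z) = argmin_{w ∈ C} ‖w - z‖`. -/
def proj (C : Set E) (z : E) : Set E :=
  {w | w ∈ C ∧ ∀ u ∈ C, ‖w - z‖ ≤ ‖u - z‖}

/-- The projection `Π_C(x; A) = P_{T_C(x)}(A)` of the set `A` onto the tangent cone to `C` at `x`.
Here `T_C(x)` is `posTangentConeAt C x`, the set of limits of `(x_k - x) / t_k` with `x_k ∈ C`,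
`t_k > 0`, `x_k → x`, `t_k → 0`. For closed `C` it is empty when `x ∉ C`. -/
def projTangent (C : Set E) (x : E) (A : Set E) : Set E :=
  {w | ∃ v ∈ A, w ∈ proj (posTangentConeAt C x) v}

end ConvexAnalysis

/-- The data of the optimization problem
`min ∑ i, f_i(x_i)` subject to `x_i ∈ Ω_i` and `∑ i, g_i(x_i) ≤ 0 ∈ ℝ^M`,
over a network of `N` agents with the undirected graph `G`. The functions `f_i` and `g_i` are
considered on the set `U i` only. -/
structure Problem (N M : ℕ) (n : Fin N → ℕ) where
  /-- the local constraint sets -/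
  Ω : ∀ i, Set (EuclideanSpace ℝ (Fin (n i)))
  /-- the domains of the local functions -/
  U : ∀ i, Set (EuclideanSpace ℝ (Fin (n i)))
  /-- the local cost functions -/
  f : ∀ i, EuclideanSpace ℝ (Fin (n i)) → ℝ
  /-- the local constraint functions -/
  g : ∀ i, EuclideanSpace ℝ (Fin (n i)) → EuclideanSpace ℝ (Fin M)
  /-- the communication graph -/
  G : SimpleGraph (Fin N)

namespace Problem

variable {N M : ℕ} {n : Fin N → ℕ} (p : Problem N M n)

/-- `Ω = ∏ i, Ω_i`, the set of the points that satisfy all the local constraints. -/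
def localSet : Set (Primal n) := {x | ∀ i, block x i ∈ p.Ω i}

/-- `∏ i, U_i`, the set on which all the local functions are defined. -/
def domain : Set (Primal n) := {x | ∀ i, block x i ∈ p.U i}

/-- The standing assumption: convexity and continuity, Slater's constraint qualification, and
connectedness of the communication graph. -/
structure Assumption : Prop where
  isCompact : ∀ i, IsCompact (p.Ω i)
  convex : ∀ i, Convex ℝ (p.Ω i)
  isOpen_domain : ∀ i, IsOpen (p.U i)
  subset_domain : ∀ i, p.Ω i ⊆ p.U i
  strictConvexOn_f : ∀ i, StrictConvexOn ℝ (p.U i) (p.f i)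
  convexOn_g : ∀ i k, ConvexOn ℝ (p.U i) (fun y => p.g i y k)
  locallyLipschitzOn_f : ∀ i, LocallyLipschitzOn (p.U i) (p.f i)
  locallyLipschitzOn_g : ∀ i, LocallyLipschitzOn (p.U i) (p.g i)
  slater : ∃ x ∈ intrinsicInterior ℝ p.localSet, ∀ k, ∑ i, p.g i (block x i) k < 0
  connected : p.G.Connected

/-- The stacked vector `col(g_1(x_1), …, g_N(x_N))`. -/
def gStack (x : Primal n) : Dual N M := WithLp.toLp 2 (fun ik => p.g ik.1 (block x ik.1) ik.2)

open Classical in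
/-- `φ(λ) = (1/2) ∑_i ∑_{j ∈ N_i} |λ_i - λ_j|`, with the `ℓ₁`-norm. -/
def phi (lam : Dual N M) : ℝ :=
  (1 / 2) * ∑ i, ∑ j ∈ p.G.neighborFinset i, ∑ k, |lam (i, k) - lam (j, k)|

/-- The modified Lagrangian `∑_i (f_i(x_i) + λ_iᵀ g_i(x_i)) - K φ(λ)`. -/
def modLagrangian (K : ℝ) (x : Primal n) (lam : Dual N M) : ℝ :=
  ∑ i, (p.f i (block x i) + ∑ k, lam (i, k) * p.g i (block x i) k) - K * p.phi lam

/-- The saddle points of the modified Lagrangian in `Ω × ℝ^{MN}_+`. -/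
def saddlePoints (K : ℝ) : Set (Primal n × Dual N M) :=
  {z | z.1 ∈ p.localSet ∧ z.2 ∈ orthant N M ∧
    (∀ lam ∈ orthant N M, p.modLagrangian K z.1 lam ≤ p.modLagrangian K z.1 z.2) ∧
    (∀ x ∈ p.localSet, p.modLagrangian K z.1 z.2 ≤ p.modLagrangian K x z.2)}

/-- The right-hand side `Π_Ω(x, -∂_x L(x, λ))` of the primal dynamics,
with `L` the modified Lagrangian. -/
def primalField (K : ℝ) (x : Primal n) (lam : Dual N M) : Set (Primal n) :=
  projTangent p.localSet x
    (-subdifferential p.domain (fun y => p.modLagrangian K y lam) x)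

/-- The right-hand side `Π(λ, -∂_λ(-L)(x, λ))` of the dual dynamics, with `L` the modified
Lagrangian and `Π` taken for the nonnegative orthant `ℝ^{MN}_+`. The subdifferential is that of the
convex function `-L(x, ·)` of all the local multipliers jointly, on the whole space. -/
def dualField (K : ℝ) (x : Primal n) (lam : Dual N M) : Set (Dual N M) :=
  projTangent (orthant N M) lam
    (-subdifferential univ (fun mu => -p.modLagrangian K x mu) lam)

/-- The solutions of the algorithm: maps on `[0, ∞)` (the values at negative times are irrelevant)
that start in `Ω × ℝ^{MN}_+`, are absolutely continuous on compact intervals and satisfy the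
differential inclusion at almost all times. -/
structure IsSolution (K : ℝ) (x : ℝ → Primal n) (lam : ℝ → Dual N M) : Prop where
  absCont_x : ∀ T : ℝ, 0 < T → AbsolutelyContinuousOnInterval x 0 T
  absCont_lam : ∀ T : ℝ, 0 < T → AbsolutelyContinuousOnInterval lam 0 T
  init_x : x 0 ∈ p.localSet
  init_lam : lam 0 ∈ orthant N M
  inclusion_x : ∀ᵐ t : ℝ, 0 < t → ∃ v ∈ p.primalField K (x t) (lam t), HasDerivAt x v t
  inclusion_lam : ∀ᵐ t : ℝ, 0 < t → ∃ w ∈ p.dualField K (x t) (lam t), HasDerivAt lam w t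

/-- The equilibria of the algorithm. -/
def equilibria (K : ℝ) : Set (Primal n × Dual N M) :=
  {z | 0 ∈ p.primalField K z.1 z.2 ∧ 0 ∈ p.dualField K z.1 z.2}

/-- Lyapunov stability of the point `z`: solutions that start close to `z` stay close to `z`. The
distance on the product is the maximum of the two Euclidean distances, which is equivalent to the
Euclidean distance of the stacked vectors. -/
def LyapunovStable (K : ℝ) (z : Primal n × Dual N M) : Prop :=
  ∀ ε > 0, ∃ δ > 0, ∀ (x : ℝ → Primal n) (lam : ℝ → Dual N M), p.IsSolution K x lam →
    dist (x 0, lam 0) z < δ → ∀ t : ℝ, 0 ≤ t → dist (x t, lam t) z < ε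

/-- Stability of the algorithm: it has equilibria, and all of them are Lyapunov stable. -/
def Stable (K : ℝ) : Prop :=
  (p.equilibria K).Nonempty ∧ ∀ z ∈ p.equilibria K, p.LyapunovStable K z

end Problem

end DistOpt

end

/-! Equilibria and saddle points coincide. At an equilibrium the projected subgradient inequality,
applied with velocity zero, gives both saddle inequalities. Conversely, a constrained minimizer of a
convex function has a subgradient whose negative projects to zero on the tangent cone, by separating
the strict epigraph from a half-cylinder over the constraint set.

Along a trajectory, `IsSaddleFlow.drop` bounds the derivative of the squared distance to any `(y,
m)` in the constraint sets by twice `L y lam - L x m`. At a saddle point this is nonpositive, which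
gives Lyapunov stability and boundedness. Convergence needs no invariance principle for differential
inclusions: a bounded trajectory is Lipschitz, so if a convergent quantity fell at a uniform rate
near a cluster point, it would fall by a fixed amount infinitely often (`not_mapClusterPt_of_drop`).
Used with the squared distance to a saddle point `s`, together with strict convexity, this forces
every cluster point to have primal part `s.1`. Hence `x` converges, and the same argument for the
squared primal distance to an arbitrary `y` shows that a cluster point is itself a saddle point.
Stability of that point upgrades clustering to convergence.

Saddle points exist because the penalty is exact. Connectedness bounds the disagreement of the
multipliers by `√N * phi`, so for `K ≥ √N * K₀` the penalty absorbs it, and only the averaged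
multiplier is left to act on the coupled constraint (`modLagrangian_le`). Slater's condition then
bounds the multipliers, and Sion's theorem on a slightly larger box gives a saddle point away from
the upper faces of the box. -/

namespace DistOpt

/-! ### Tangent cones of convex sets and projected subgradients -/

section TangentCone

variable {E : Type*} [NormedAddCommGroup E] [InnerProductSpace ℝ E] {C : Set E} {x y v w : E}

theorem isClosed_posTangentConeAt (C : Set E) (x : E) : IsClosed (posTangentConeAt C x) := by
  rw [posTangentConeAt, tangentConeAt_eq_biInter_closure]
  exact isClosed_biInter fun _ _ => isClosed_closure

/-- Reduces closed conditions on tangent vectors to the generators `c • (z - x)`. -/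
theorem posTangentConeAt_subset_closure_smul :
    posTangentConeAt C x ⊆ closure {w | ∃ c : ℝ, 0 ≤ c ∧ ∃ z ∈ C, w = c • (z - x)} := by
  intro w hw
  obtain ⟨α, l, hl, c, d, -, hd, hcd⟩ := exists_fun_of_mem_tangentConeAt hw
  refine mem_closure_of_tendsto hcd (hd.mono fun a ha => ⟨c a, (c a).2, x + d a, ha, ?_⟩)
  simp [NNReal.smul_def]

theorem smul_mem_posTangentConeAt (hw : w ∈ posTangentConeAt C x) {c : ℝ} (hc : 0 ≤ c) :
    c • w ∈ posTangentConeAt C x := by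
  obtain ⟨α, l, hl, a, d, hd0, hd, hcd⟩ := exists_fun_of_mem_tangentConeAt hw
  refine mem_tangentConeAt_of_seq l (fun i => c.toNNReal * a i) d hd0 hd ?_
  simpa [NNReal.smul_def, mul_smul, hc] using hcd.const_smul c

theorem sub_mem_posTangentConeAt (hC : Convex ℝ C) (hx : x ∈ C) (hy : y ∈ C) :
    y - x ∈ posTangentConeAt C x :=
  sub_mem_posTangentConeAt_of_segment_subset (hC.segment_subset hx hy)

/-- For a generator, `c • (z - x) + s • (y - x)` is `c + s` times `z' - x`, with `z'` the convex
combination of `z` and `y` of weights `c / (c + s)` and `s / (c + s)`; the general case follows by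
closure. These are the variations against which the projection is tested. -/
theorem add_smul_sub_mem_posTangentConeAt (hC : Convex ℝ C) (hx : x ∈ C) (hy : y ∈ C)
    (hw : w ∈ posTangentConeAt C x) {s : ℝ} (hs : 0 ≤ s) :
    w + s • (y - x) ∈ posTangentConeAt C x := by
  have key : MapsTo (fun w => w + s • (y - x))
      {w | ∃ c : ℝ, 0 ≤ c ∧ ∃ z ∈ C, w = c • (z - x)} (posTangentConeAt C x) := by
    rintro _ ⟨c, hc, z, hz, rfl⟩
    rcases eq_or_lt_of_le (add_nonneg hc hs) with h | h
    · have hs0 : s = 0 := by linarith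
      have hc0 : c = 0 := by linarith
      simpa [hs0, hc0] using zero_mem_tangentConeAt (𝕜 := NNReal) (subset_closure hx)
    · have hz' := hC hz hy (div_nonneg hc h.le) (div_nonneg hs h.le)
        (by rw [← add_div, div_self h.ne'])
      have := smul_mem_posTangentConeAt (sub_mem_posTangentConeAt hC hx hz') h.le
      convert! this using 1
      beta_reduce
      rw [smul_sub (c + s), smul_add, smul_smul, smul_smul, mul_div_cancel₀ _ h.ne',
        mul_div_cancel₀ _ h.ne']
      module
  have := map_mem_closure (by fun_prop) (posTangentConeAt_subset_closure_smul hw) key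
  rwa [(isClosed_posTangentConeAt C x).closure_eq] at this

theorem inner_nonpos_of_mem_posTangentConeAt (hv : ∀ y ∈ C, inner ℝ v (y - x) ≤ 0)
    (hw : w ∈ posTangentConeAt C x) : inner ℝ v w ≤ 0 := by
  have hcl : IsClosed {w : E | inner ℝ v w ≤ 0} :=
    isClosed_le (by fun_prop) continuous_const
  refine closure_minimal ?_ hcl (posTangentConeAt_subset_closure_smul hw)
  rintro _ ⟨c, hc, z, hz, rfl⟩
  simp only [mem_ofPred_eq, inner_smul_right]
  exact mul_nonpos_of_nonneg_of_nonpos hc (hv z hz)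

theorem nonneg_of_forall_quadratic_nonneg {a b : ℝ} (hb : 0 ≤ b)
    (h : ∀ s : ℝ, 0 ≤ s → 0 ≤ 2 * s * a + s ^ 2 * b) : 0 ≤ a := by
  by_contra! ha
  -- A step at which the linear term dominates; `b + 1` also covers `b = 0`.
  have hs : 0 < -a / (b + 1) := div_pos (by linarith) (by linarith)
  have h1 := h _ hs.le
  have h2 : -a / (b + 1) * (b + 1) = -a := div_mul_cancel₀ _ (by linarith)
  nlinarith

/-- The variational inequality for the projection onto the tangent cone of a convex set. -/
theorem inner_le_of_mem_proj_posTangentConeAt (hC : Convex ℝ C) (hx : x ∈ C) (hy : y ∈ C)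
    (hw : w ∈ proj (posTangentConeAt C x) v) : inner ℝ v (y - x) ≤ inner ℝ w (y - x) := by
  have : 0 ≤ inner ℝ (w - v) (y - x) := by
    refine nonneg_of_forall_quadratic_nonneg (sq_nonneg ‖y - x‖) fun s hs => ?_
    have h1 := hw.2 _ (add_smul_sub_mem_posTangentConeAt hC hx hy hw.1 hs)
    have h2 : ‖w - v‖ ^ 2 ≤ ‖(w - v) + s • (y - x)‖ ^ 2 := by
      gcongr
      rwa [sub_add_eq_add_sub]
    rw [norm_add_sq_real, inner_smul_right, norm_smul, mul_pow, Real.norm_eq_abs, sq_abs] at h2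
    linarith
  rw [inner_sub_left] at this
  linarith

theorem mem_of_mem_projTangent (hC : IsClosed C) {A : Set E} (hw : w ∈ projTangent C x A) :
    x ∈ C := by
  obtain ⟨v, -, hv, -⟩ := hw
  simpa [hC.closure_eq] using mem_closure_of_nonempty_tangentConeAt ⟨_, hv⟩

/-- The subgradient inequality survives the projection. With `w` the velocity of `x`, the left side
is half the derivative of `‖x - y‖ ^ 2`, so this is the source of all the Lyapunov estimates. -/
theorem inner_le_of_mem_projTangent_neg_subdifferential (hC : Convex ℝ C) (hC' : IsClosed C)
    {U : Set E} (hCU : C ⊆ U) {F : E → ℝ} (hw : w ∈ projTangent C x (-subdifferential U F x))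
    (hy : y ∈ C) : inner ℝ (x - y) w ≤ F y - F x := by
  have hx := mem_of_mem_projTangent hC' hw
  obtain ⟨v, ⟨-, hv⟩, hvw⟩ := hw
  have h1 := hv y (hCU hy)
  have h2 := inner_le_of_mem_proj_posTangentConeAt hC hx hy hvw
  rw [inner_neg_left] at h1
  rw [← neg_sub y x, inner_neg_left, real_inner_comm]
  linarith

theorem norm_le_of_mem_subdifferential {U : Set E} {F : E → ℝ} (hv : v ∈ subdifferential U F x)
    {r B : ℝ} (hr : 0 < r) (hU : Metric.closedBall x r ⊆ U)
    (hB : ∀ y ∈ Metric.closedBall x r, |F y| ≤ B) : ‖v‖ ≤ 2 * B / r := by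
  rcases eq_or_ne v 0 with rfl | h0
  · rw [norm_zero]
    have := (abs_nonneg _).trans (hB x (Metric.mem_closedBall_self hr.le))
    positivity
  have hn : 0 < ‖v‖ := norm_pos_iff.2 h0
  -- The subgradient inequality is tested at distance `r` in the direction of `v`.
  have hmem : x + (r / ‖v‖) • v ∈ Metric.closedBall x r := by
    rw [mem_closedBall_iff_norm, add_sub_cancel_left, norm_smul, Real.norm_eq_abs,
      abs_of_pos (by positivity), div_mul_cancel₀ _ hn.ne']
  have h1 := hv.2 _ (hU hmem)
  have h2 := abs_le.1 (hB _ hmem)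
  have h3 := abs_le.1 (hB x (Metric.mem_closedBall_self hr.le))
  rw [add_sub_cancel_left, inner_smul_right, real_inner_self_eq_norm_sq] at h1
  have h4 : r / ‖v‖ * ‖v‖ ^ 2 = ‖v‖ * r := by field_simp
  rw [le_div_iff₀ hr]
  linarith

theorem norm_le_of_mem_projTangent_neg_subdifferential {U : Set E} {F : E → ℝ}
    (hw : w ∈ projTangent C x (-subdifferential U F x))
    {r B : ℝ} (hr : 0 < r) (hU : Metric.closedBall x r ⊆ U)
    (hB : ∀ y ∈ Metric.closedBall x r, |F y| ≤ B) : ‖w‖ ≤ 4 * B / r := by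
  obtain ⟨v, hv, hw, hmin⟩ := hw
  have h1 := norm_le_of_mem_subdifferential hv hr hU hB
  -- Zero lies in the cone, so the projection is no farther from `v` than zero is; this at most
  -- doubles the norm.
  have h2 := hmin 0 (zero_mem_tangentConeAt (mem_closure_of_nonempty_tangentConeAt ⟨_, hw⟩))
  rw [zero_sub] at h2
  rw [norm_neg] at h1 h2
  rw [norm_sub_rev] at h2
  rw [show 4 * B / r = 2 * B / r + 2 * B / r by ring]
  have h4 := norm_sub_norm_le w v
  rw [norm_sub_rev] at h4
  linarith

/-- A minimizer over `C` of a convex function that is continuous on an open convex neighbourhood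
of `C` is a stationary point of the projected subgradient field. -/
theorem zero_mem_projTangent_neg_subdifferential [CompleteSpace E] (hC : Convex ℝ C) {U : Set E}
    (hCU : C ⊆ U) (hU : IsOpen U) {F : E → ℝ} (hF : ConvexOn ℝ U F) (hFc : ContinuousOn F U)
    (hx : x ∈ C) (hmin : ∀ y ∈ C, F x ≤ F y) :
    0 ∈ projTangent C x (-subdifferential U F x) := by
  have hS : IsOpen {q : E × ℝ | q.1 ∈ U ∧ F q.1 < q.2} := by
    have h1 : ContinuousOn (fun q : E × ℝ => q.2 - F q.1) (U ×ˢ univ) :=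
      continuousOn_snd.sub (hFc.comp continuousOn_fst fun q hq => hq.1)
    have h2 := h1.isOpen_inter_preimage (hU.prod isOpen_univ) (isOpen_Ioi (a := (0 : ℝ)))
    convert! h2 using 1
    ext q
    simp
  have hT : Convex ℝ (C ×ˢ Iic (F x)) := hC.prod (convex_Iic _)
  have hdisj : Disjoint {q : E × ℝ | q.1 ∈ U ∧ F q.1 < q.2} (C ×ˢ Iic (F x)) := by
    rw [disjoint_left]
    rintro ⟨y, r⟩ ⟨-, h1⟩ ⟨h2, h3⟩
    have := hmin y h2
    simp only [mem_Iic] at h1 h3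
    linarith
  -- Minimality makes the open strict epigraph disjoint from the cylinder `C ×ˢ Iic (F x)`. A
  -- separating functional has the form `⟪a, y⟫ + b * r`, and moving up from `(x, F x)` shows `b <
  -- 0`.
  obtain ⟨f, u, hfS, hfT⟩ :=
    geometric_hahn_banach_open hF.convex_strict_epigraph hS hT hdisj
  obtain ⟨a, b, hab⟩ : ∃ (a : E) (b : ℝ), ∀ y r, f (y, r) = inner ℝ a y + b * r := by
    refine ⟨(InnerProductSpace.toDual ℝ E).symm (f.comp (ContinuousLinearMap.inl ℝ E ℝ)),
      f (0, 1), fun y r => ?_⟩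
    rw [InnerProductSpace.toDual_symm_apply]
    have h1 : ((y, r) : E × ℝ) = (y, 0) + r • (0, 1) := by simp
    rw [h1, map_add, map_smul, smul_eq_mul, mul_comm]
    simp
  have hxT := hfT (x, F x) ⟨hx, le_refl (F x)⟩
  rw [hab] at hxT
  have hb : b < 0 := by
    have := hfS (x, F x + 1) ⟨hCU hx, by simp⟩
    rw [hab] at this
    linarith
  have hepi : ∀ y ∈ U, inner ℝ a y + b * F y ≤ u := by
    intro y hy
    have h1 : Tendsto (fun r : ℝ => inner ℝ a y + b * r) (𝓝[>] (F y))
        (𝓝 (inner ℝ a y + b * F y)) :=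
      (Continuous.tendsto (by fun_prop) _).mono_left nhdsWithin_le_nhds
    refine le_of_tendsto h1 (eventually_mem_nhdsWithin.mono fun r hr => ?_)
    rw [← hab]
    exact (hfS (y, r) ⟨hy, hr⟩).le
  have hxu : inner ℝ a x + b * F x = u := le_antisymm (hepi x (hCU hx)) hxT
  -- The epigraph side makes `-b⁻¹ • a` a subgradient; the cylinder side makes `b⁻¹ • a` normal to
  -- `C` at `x`, so its projection onto the tangent cone is zero.
  refine ⟨b⁻¹ • a, ⟨hCU hx, fun y hy => ?_⟩,
    zero_mem_tangentConeAt (subset_closure hx), fun w hw => ?_⟩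
  · have h1 := hepi y hy
    rw [inner_neg_left, inner_smul_left, inner_sub_right]
    simp only [conj_trivial]
    have h2 : inner ℝ a y - inner ℝ a x ≤ -b * (F y - F x) := by linarith
    have h3 : -b⁻¹ * (inner ℝ a y - inner ℝ a x) ≤ -b⁻¹ * (-b * (F y - F x)) :=
      mul_le_mul_of_nonneg_left h2 (neg_nonneg.2 (inv_nonpos.2 hb.le))
    have h4 : -b⁻¹ * (-b * (F y - F x)) = F y - F x := by
      have := hb.ne
      field_simp
    linarith
  · have h1 : inner ℝ (b⁻¹ • a) w ≤ 0 := by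
      refine inner_nonpos_of_mem_posTangentConeAt (fun y hy => ?_) hw
      have := hfT (y, F x) ⟨hy, le_refl (F x)⟩
      rw [hab] at this
      rw [inner_smul_left, inner_sub_right]
      exact mul_nonpos_of_nonpos_of_nonneg (by simpa using hb.le) (by linarith)
    have h2 : ‖0 - b⁻¹ • a‖ ^ 2 ≤ ‖w - b⁻¹ • a‖ ^ 2 := by
      rw [zero_sub, norm_neg, norm_sub_sq_real, real_inner_comm]
      nlinarith [sq_nonneg ‖w‖]
    exact (sq_le_sq₀ (norm_nonneg _) (norm_nonneg _)).1 h2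

end TangentCone

/-! ### Increments of absolutely continuous curves -/

section AbsolutelyContinuous

theorem _root_.AbsolutelyContinuousOnInterval.lipschitz_comp {X Y : Type*} [PseudoMetricSpace X]
    [PseudoMetricSpace Y] {f : ℝ → X} {a b : ℝ} (hf : AbsolutelyContinuousOnInterval f a b)
    {φ : X → Y} {K : NNReal} (hφ : LipschitzWith K φ) :
    AbsolutelyContinuousOnInterval (fun t => φ (f t)) a b := by
  have h := Filter.Tendsto.const_mul (K : ℝ) hf
  rw [mul_zero] at h
  refine squeeze_zero (fun _ => Finset.sum_nonneg fun _ _ => dist_nonneg) (fun J => ?_) h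
  rw [Finset.mul_sum]
  exact Finset.sum_le_sum fun i _ => hφ.dist_le_mul _ _

theorem _root_.AbsolutelyContinuousOnInterval.norm_sq {E : Type*} [NormedAddCommGroup E]
    {f : ℝ → E} {a b : ℝ} (hf : AbsolutelyContinuousOnInterval f a b) :
    AbsolutelyContinuousOnInterval (fun t => ‖f t‖ ^ 2) a b := by
  have h := hf.lipschitz_comp (φ := norm) lipschitzWith_one_norm
  simpa only [sq] using h.fun_mul h

theorem _root_.AbsolutelyContinuousOnInterval.const {X : Type*} [PseudoMetricSpace X]
    (c : X) (a b : ℝ) : AbsolutelyContinuousOnInterval (fun _ : ℝ => c) a b :=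
  ((LipschitzWith.const c).lipschitzOnWith (s := uIcc a b)).absolutelyContinuousOnInterval

theorem _root_.AbsolutelyContinuousOnInterval.sub_le_of_ae_hasDerivAt_le {f : ℝ → ℝ} {a b c : ℝ}
    (hf : AbsolutelyContinuousOnInterval f a b) (hab : a ≤ b)
    (h : ∀ᵐ t, t ∈ Ioo a b → ∃ d ≤ c, HasDerivAt f d t) : f b - f a ≤ c * (b - a) := by
  rw [← hf.integral_deriv_eq_sub]
  calc ∫ t in a..b, deriv f t ≤ ∫ _ in a..b, c := by
        refine intervalIntegral.integral_mono_ae_restrict hab hf.intervalIntegrable_deriv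
          intervalIntegrable_const ?_
        rw [Filter.EventuallyLE, ← restrict_Ioo_eq_restrict_Icc, ae_restrict_iff' measurableSet_Ioo]
        filter_upwards [h] with t ht hmem
        obtain ⟨d, hd, hfd⟩ := ht hmem
        rwa [hfd.deriv]
    _ = c * (b - a) := by simp [mul_comm]

theorem _root_.AbsolutelyContinuousOnInterval.norm_sub_le_of_ae_norm_hasDerivAt_le {E : Type*}
    [NormedAddCommGroup E] [InnerProductSpace ℝ E] {f : ℝ → E} {a b B : ℝ}
    (hf : AbsolutelyContinuousOnInterval f a b) (hab : a ≤ b)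
    (h : ∀ᵐ t, t ∈ Ioo a b → ∃ v, ‖v‖ ≤ B ∧ HasDerivAt f v t) : ‖f b - f a‖ ≤ B * (b - a) := by
  set u := f b - f a with hu
  rcases eq_or_ne u 0 with h0 | h0
  · rw [h0, norm_zero]
    rcases eq_or_lt_of_le hab with rfl | hlt
    · simp
    -- With zero increment only `0 ≤ B` is needed; any single time at which the derivative bound
    -- holds provides it.
    have hne : ∃ᵐ t, t ∈ Ioo a b := by
      rw [frequently_ae_mem_iff]
      simp [hlt]
    obtain ⟨t, ht, ht'⟩ := (hne.and_eventually h).exists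
    obtain ⟨v, hv, -⟩ := ht' ht
    exact mul_nonneg ((norm_nonneg v).trans hv) (by linarith)
  -- Pairing with the increment `u` itself reduces the bound to the scalar case.
  have hac := hf.lipschitz_comp (innerSL ℝ u).lipschitz
  have h1 := hac.sub_le_of_ae_hasDerivAt_le (c := ‖u‖ * B) hab (by
    filter_upwards [h] with t ht hmem
    obtain ⟨v, hv, hfv⟩ := ht hmem
    refine ⟨inner ℝ u v, (real_inner_le_norm u v).trans (by gcongr), ?_⟩
    exact (innerSL ℝ u).hasFDerivAt.comp_hasDerivAt t hfv)
  simp only [innerSL_apply_apply] at h1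
  rw [← inner_sub_right, ← hu, real_inner_self_eq_norm_sq, sq, mul_assoc] at h1
  exact le_of_mul_le_mul_left h1 (norm_pos_iff.2 h0)

end AbsolutelyContinuous

/-! ### Stability and convergence of projected saddle flows -/

section SaddleFlow

/-- A set of full measure is dense, and membership in a closed set passes to limits. -/
theorem mem_of_ae_mem_of_continuousOn {X : Type*} [TopologicalSpace X] {f : ℝ → X} {S : Set X}
    (hS : IsClosed S) (hf : ContinuousOn f (Ici 0)) (h : ∀ᵐ t : ℝ, 0 < t → f t ∈ S) {t : ℝ}
    (ht : 0 < t) : f t ∈ S := by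
  have h1 : t ∈ closure (Ioi 0 ∩ {t : ℝ | 0 < t → f t ∈ S}) :=
    (Measure.dense_of_ae h).open_subset_closure_inter isOpen_Ioi ht
  have h2 : ContinuousWithinAt f (Ioi 0 ∩ {t : ℝ | 0 < t → f t ∈ S}) t :=
    (hf t ht.le).mono fun s hs => mem_Ici.2 (le_of_lt (mem_Ioi.1 hs.1))
  have h3 := h2.mem_closure h1 (t := S) fun s hs => hs.2 hs.1
  rwa [hS.closure_eq] at h3

theorem continuousOn_Ici_of_absolutelyContinuousOnInterval {X : Type*} [SeminormedAddCommGroup X]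
    {f : ℝ → X} (h : ∀ T : ℝ, 0 < T → AbsolutelyContinuousOnInterval f 0 T) :
    ContinuousOn f (Ici 0) := by
  intro t ht
  have ht' : 0 ≤ t := mem_Ici.1 ht
  have hle : 0 ≤ t + 1 := by linarith
  have h1 : ContinuousOn f (uIcc 0 (t + 1)) :=
    AbsolutelyContinuousOnInterval.continuousOn (h (t + 1) (by linarith))
  rw [uIcc_of_le hle] at h1
  have h2 : Icc 0 (t + 1) ∈ 𝓝[Ici 0] t := by
    rw [← Ici_inter_Iic]
    exact inter_mem self_mem_nhdsWithin
      (mem_nhdsWithin_of_mem_nhds (Iic_mem_nhds (lt_add_one t)))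
  exact (h1 t (mem_Icc.2 ⟨ht', by linarith⟩)).mono_of_mem_nhdsWithin h2

/-- Each time the Lipschitz curve comes near `q` it stays in `O` for a fixed duration `τ`, so `h`
falls by at least `η * τ`. Near its limit `h` varies by less than that. -/
theorem not_mapClusterPt_of_drop {Z : Type*} [PseudoMetricSpace Z] {z : ℝ → Z} {B : ℝ}
    (hB : 0 ≤ B) (hz : ∀ a b, 0 ≤ a → a ≤ b → dist (z b) (z a) ≤ B * (b - a)) {h : ℝ → ℝ} {l : ℝ}
    (hh : Tendsto h atTop (𝓝 l)) {q : Z} {O : Set Z} (hO : O ∈ 𝓝 q) {η : ℝ} (hη : 0 < η)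
    (hdrop : ∀ a b, 0 ≤ a → a ≤ b → (∀ t ∈ Ioo a b, z t ∈ O) → h b - h a ≤ -η * (b - a)) :
    ¬ MapClusterPt q atTop z := by
  intro hq
  obtain ⟨ε, hε, hball⟩ := Metric.mem_nhds_iff.1 hO
  -- Starting within `ε / 2` of `q`, the curve needs longer than `τ` to leave the `ε`-ball; `B + 1`
  -- avoids division by zero.
  set τ := ε / 2 / (B + 1) with hτ
  have hτ0 : 0 < τ := by positivity
  have hBτ : B * τ < ε / 2 := by
    have : (B + 1) * τ = ε / 2 := by rw [hτ]; field_simp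
    linarith
  have hev : ∀ᶠ t in atTop, |h t - l| < η * τ / 2 := by
    simpa [Real.dist_eq] using Metric.tendsto_nhds.1 hh (η * τ / 2) (by positivity)
  obtain ⟨T, hT⟩ := eventually_atTop.1 hev
  have hfr := mapClusterPt_iff_frequently.1 hq _ (Metric.ball_mem_nhds q (half_pos hε))
  obtain ⟨a, ha, haT⟩ := (hfr.and_eventually (eventually_ge_atTop (max T 0))).exists
  have ha0 : 0 ≤ a := (le_max_right _ _).trans haT
  have haT' : T ≤ a := (le_max_left _ _).trans haT
  have h1 := hdrop a (a + τ) ha0 (by linarith) (fun t ht => hball ?_)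
  · have h2 := abs_lt.1 (hT a haT')
    have h3 := abs_lt.1 (hT (a + τ) (by linarith))
    rw [add_sub_cancel_left] at h1
    linarith
  · rw [Metric.mem_ball] at ha ⊢
    have h2 := hz a t ha0 ht.1.le
    have h3 : B * (t - a) ≤ B * τ := mul_le_mul_of_nonneg_left (by linarith [ht.2]) hB
    linarith [dist_triangle (z t) (z a) q]

variable {E F : Type*} [NormedAddCommGroup E] [InnerProductSpace ℝ E]
  [NormedAddCommGroup F] [InnerProductSpace ℝ F]

/-- The saddle points of `L` in `C × D`. -/
def saddleSet (C : Set E) (D : Set F) (L : E → F → ℝ) : Set (E × F) :=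
  {z | z.1 ∈ C ∧ z.2 ∈ D ∧ (∀ m ∈ D, L z.1 m ≤ L z.1 z.2) ∧ (∀ x ∈ C, L z.1 z.2 ≤ L x z.2)}

/-- The trajectories of the projected primal-dual subgradient flow of `L` on `C × D`, where
`L` is considered on `U × F`. -/
structure IsSaddleFlow (C U : Set E) (D : Set F) (L : E → F → ℝ) (x : ℝ → E) (lam : ℝ → F) :
    Prop where
  absCont_x : ∀ T : ℝ, 0 < T → AbsolutelyContinuousOnInterval x 0 T
  absCont_lam : ∀ T : ℝ, 0 < T → AbsolutelyContinuousOnInterval lam 0 T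
  init_x : x 0 ∈ C
  init_lam : lam 0 ∈ D
  inclusion_x : ∀ᵐ t : ℝ, 0 < t →
    ∃ v ∈ projTangent C (x t) (-subdifferential U (fun y => L y (lam t)) (x t)), HasDerivAt x v t
  inclusion_lam : ∀ᵐ t : ℝ, 0 < t →
    ∃ w ∈ projTangent D (lam t) (-subdifferential univ (fun m => -L (x t) m) (lam t)),
      HasDerivAt lam w t

namespace IsSaddleFlow

variable {C U : Set E} {D : Set F} {L : E → F → ℝ} {x : ℝ → E} {lam : ℝ → F}

theorem mem_left (h : IsSaddleFlow C U D L x lam) (hC : IsClosed C) {t : ℝ} (ht : 0 ≤ t) :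
    x t ∈ C := by
  rcases eq_or_lt_of_le ht with rfl | ht
  · exact h.init_x
  refine mem_of_ae_mem_of_continuousOn hC
    (continuousOn_Ici_of_absolutelyContinuousOnInterval h.absCont_x) ?_ ht
  filter_upwards [h.inclusion_x] with s hs hs0
  obtain ⟨v, hv, -⟩ := hs hs0
  exact mem_of_mem_projTangent hC hv

theorem mem_right (h : IsSaddleFlow C U D L x lam) (hD : IsClosed D) {t : ℝ} (ht : 0 ≤ t) :
    lam t ∈ D := by
  rcases eq_or_lt_of_le ht with rfl | ht
  · exact h.init_lam
  refine mem_of_ae_mem_of_continuousOn hD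
    (continuousOn_Ici_of_absolutelyContinuousOnInterval h.absCont_lam) ?_ ht
  filter_upwards [h.inclusion_lam] with s hs hs0
  obtain ⟨v, hv, -⟩ := hs hs0
  exact mem_of_mem_projTangent hD hv

theorem absCont_left (h : IsSaddleFlow C U D L x lam) {a b : ℝ} (ha : 0 ≤ a) (hab : a ≤ b) :
    AbsolutelyContinuousOnInterval x a b :=
  (h.absCont_x (b + 1) (by linarith)).mono (by
    rw [uIcc_of_le hab, uIcc_of_le (by linarith)]; exact Icc_subset_Icc ha (by linarith))

theorem absCont_right (h : IsSaddleFlow C U D L x lam) {a b : ℝ} (ha : 0 ≤ a) (hab : a ≤ b) :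
    AbsolutelyContinuousOnInterval lam a b :=
  (h.absCont_lam (b + 1) (by linarith)).mono (by
    rw [uIcc_of_le hab, uIcc_of_le (by linarith)]; exact Icc_subset_Icc ha (by linarith))

/-- The primal half alone: `y` is compared with `x` at the current multiplier, which later tests
whether a limit minimizes over `C`. -/
theorem drop_left (h : IsSaddleFlow C U D L x lam) (hC : Convex ℝ C) (hC' : IsClosed C)
    (hCU : C ⊆ U) {y : E} (hy : y ∈ C) {a b η : ℝ} (ha : 0 ≤ a) (hab : a ≤ b)
    (hη : ∀ t ∈ Ioo a b, η ≤ L (x t) (lam t) - L y (lam t)) :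
    ‖x b - y‖ ^ 2 - ‖x a - y‖ ^ 2 ≤ -(2 * η) * (b - a) := by
  have hac := ((h.absCont_left ha hab).sub (.const y a b)).norm_sq
  refine hac.sub_le_of_ae_hasDerivAt_le hab ?_
  filter_upwards [h.inclusion_x] with t ht hmem
  obtain ⟨v, hv, hxv⟩ := ht (ha.trans_lt hmem.1)
  refine ⟨_, ?_, (hxv.sub_const y).norm_sq⟩
  have := inner_le_of_mem_projTangent_neg_subdifferential hC hC' hCU hv hy
  linarith [hη t hmem]

/-- The terms `L (x t) (lam t)` of the primal and dual inequalities cancel in the sum. -/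
theorem drop (h : IsSaddleFlow C U D L x lam) (hC : Convex ℝ C) (hC' : IsClosed C)
    (hCU : C ⊆ U) (hD : Convex ℝ D) (hD' : IsClosed D) {y : E} (hy : y ∈ C) {m : F} (hm : m ∈ D)
    {a b η : ℝ} (ha : 0 ≤ a) (hab : a ≤ b)
    (hη : ∀ t ∈ Ioo a b, η ≤ L (x t) m - L y (lam t)) :
    (‖x b - y‖ ^ 2 + ‖lam b - m‖ ^ 2) - (‖x a - y‖ ^ 2 + ‖lam a - m‖ ^ 2) ≤
      -(2 * η) * (b - a) := by
  have hac := ((h.absCont_left ha hab).sub (.const y a b)).norm_sq.fun_add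
    ((h.absCont_right ha hab).sub (.const m a b)).norm_sq
  refine hac.sub_le_of_ae_hasDerivAt_le hab ?_
  filter_upwards [h.inclusion_x, h.inclusion_lam] with t ht ht' hmem
  obtain ⟨v, hv, hxv⟩ := ht (ha.trans_lt hmem.1)
  obtain ⟨w, hw, hlw⟩ := ht' (ha.trans_lt hmem.1)
  refine ⟨_, ?_, (hxv.sub_const y).norm_sq.add (hlw.sub_const m).norm_sq⟩
  have h1 := inner_le_of_mem_projTangent_neg_subdifferential hC hC' hCU hv hy
  have h2 := inner_le_of_mem_projTangent_neg_subdifferential hD hD' (subset_univ D) hw hm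
  linarith [hη t hmem]

/-- The squared distance to a saddle point does not increase along trajectories. -/
theorem norm_sq_add_norm_sq_le (h : IsSaddleFlow C U D L x lam) (hC : Convex ℝ C)
    (hC' : IsClosed C) (hCU : C ⊆ U) (hD : Convex ℝ D) (hD' : IsClosed D) {z : E × F}
    (hz : z ∈ saddleSet C D L) {a b : ℝ} (ha : 0 ≤ a) (hab : a ≤ b) :
    ‖x b - z.1‖ ^ 2 + ‖lam b - z.2‖ ^ 2 ≤ ‖x a - z.1‖ ^ 2 + ‖lam a - z.2‖ ^ 2 := by
  have := h.drop hC hC' hCU hD hD' hz.1 hz.2.1 ha hab (η := 0) fun t ht => by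
    have ht0 : 0 ≤ t := ha.trans ht.1.le
    have h1 := hz.2.2.1 _ (h.mem_right hD' ht0)
    have h2 := hz.2.2.2 _ (h.mem_left hC' ht0)
    linarith
  linarith

theorem exists_lipschitz [ProperSpace E] [ProperSpace F] (h : IsSaddleFlow C U D L x lam)
    (hC : IsCompact C) (hU : IsOpen U) (hCU : C ⊆ U)
    (hL : ContinuousOn (fun q : E × F => L q.1 q.2) (U ×ˢ univ)) {R : ℝ}
    (hR : ∀ t, 0 ≤ t → ‖lam t‖ ≤ R) :
    ∃ B, 0 ≤ B ∧ ∀ a b, 0 ≤ a → a ≤ b →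
      dist ((x b, lam b) : E × F) (x a, lam a) ≤ B * (b - a) := by
  -- Balls of one radius `r` around the trajectory stay in a compact set on which `L` is bounded,
  -- and this bounds all the velocities.
  obtain ⟨r, hr, hrU⟩ := hC.exists_cthickening_subset_open hU hCU
  have hK : IsCompact (Metric.cthickening r C ×ˢ Metric.closedBall (0 : F) (R + r)) :=
    hC.cthickening.prod (isCompact_closedBall _ _)
  obtain ⟨B, hB⟩ := hK.exists_bound_of_continuousOn
    (hL.mono (prod_mono hrU (subset_univ _)))
  have hB' : ∀ y ∈ Metric.cthickening r C, ∀ m ∈ Metric.closedBall (0 : F) (R + r),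
      |L y m| ≤ B := fun y hy m hm => hB (y, m) ⟨hy, hm⟩
  have hball : ∀ t, 0 ≤ t → Metric.closedBall (x t) r ⊆ Metric.cthickening r C := fun t ht =>
    Metric.closedBall_subset_cthickening (h.mem_left hC.isClosed ht) r
  have hball' : ∀ t, 0 ≤ t → Metric.closedBall (lam t) r ⊆ Metric.closedBall 0 (R + r) := by
    intro t ht
    refine Metric.closedBall_subset_closedBall' ?_
    rw [dist_zero_right]
    linarith [hR t ht]
  have hB0 : 0 ≤ B := (abs_nonneg _).trans
    (hB' (x 0) (hball 0 le_rfl (Metric.mem_closedBall_self hr.le)) (lam 0)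
      (hball' 0 le_rfl (Metric.mem_closedBall_self hr.le)))
  refine ⟨4 * B / r, by positivity, fun a b ha hab => ?_⟩
  rw [Prod.dist_eq, dist_eq_norm, dist_eq_norm]
  refine max_le ?_ ?_
  · refine (h.absCont_left ha hab).norm_sub_le_of_ae_norm_hasDerivAt_le hab ?_
    filter_upwards [h.inclusion_x] with t ht hmem
    have ht0 : 0 < t := ha.trans_lt hmem.1
    obtain ⟨v, hv, hxv⟩ := ht ht0
    refine ⟨v, norm_le_of_mem_projTangent_neg_subdifferential hv hr
      ((hball t ht0.le).trans hrU) fun y hy => ?_, hxv⟩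
    exact hB' y (hball t ht0.le hy) _ (hball' t ht0.le (Metric.mem_closedBall_self hr.le))
  · refine (h.absCont_right ha hab).norm_sub_le_of_ae_norm_hasDerivAt_le hab ?_
    filter_upwards [h.inclusion_lam] with t ht hmem
    have ht0 : 0 < t := ha.trans_lt hmem.1
    obtain ⟨v, hv, hxv⟩ := ht ht0
    refine ⟨v, norm_le_of_mem_projTangent_neg_subdifferential hv hr (subset_univ _)
      fun y hy => ?_, hxv⟩
    rw [abs_neg]
    exact hB' _ (hball t ht0.le (Metric.mem_closedBall_self hr.le)) _ (hball' t ht0.le hy)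

/-- Trajectories that start close to a saddle point stay close to it. -/
theorem dist_lt_of_dist_lt (h : IsSaddleFlow C U D L x lam) (hC : Convex ℝ C)
    (hC' : IsClosed C) (hCU : C ⊆ U) (hD : Convex ℝ D) (hD' : IsClosed D) {z : E × F}
    (hz : z ∈ saddleSet C D L) {ε : ℝ} (hε : 0 < ε)
    {a b : ℝ} (ha : 0 ≤ a) (hab : a ≤ b) (hdist : dist (x a, lam a) z < ε / 2) :
    dist (x b, lam b) z < ε := by
  have hV := h.norm_sq_add_norm_sq_le hC hC' hCU hD hD' hz ha hab
  rw [Prod.dist_eq, max_lt_iff, dist_eq_norm, dist_eq_norm] at hdist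
  rw [Prod.dist_eq, max_lt_iff, dist_eq_norm, dist_eq_norm]
  -- The initial sum of squares is below `2 * (ε / 2) ^ 2`, hence below `ε ^ 2`: the halving pays
  -- for passing from the maximum distance to the sum of squares.
  have h1 := pow_lt_pow_left₀ hdist.1 (norm_nonneg _) two_ne_zero
  have h2 := pow_lt_pow_left₀ hdist.2 (norm_nonneg _) two_ne_zero
  constructor
  · refine lt_of_pow_lt_pow_left₀ 2 hε.le ?_
    nlinarith [sq_nonneg ‖lam b - z.2‖]
  · refine lt_of_pow_lt_pow_left₀ 2 hε.le ?_
    nlinarith [sq_nonneg ‖x b - z.1‖]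

/-- Every trajectory of the projected primal-dual subgradient flow converges to a saddle point,
if the primal components of saddle points are strict minimizers. -/
theorem exists_tendsto_saddle [ProperSpace E] [ProperSpace F] (h : IsSaddleFlow C U D L x lam)
    (hC : IsCompact C) (hC' : Convex ℝ C) (hU : IsOpen U) (hCU : C ⊆ U)
    (hD : IsClosed D) (hD' : Convex ℝ D)
    (hL : ContinuousOn (fun q : E × F => L q.1 q.2) (U ×ˢ univ))
    (hne : (saddleSet C D L).Nonempty)
    (hstrict : ∀ z ∈ saddleSet C D L, ∀ y ∈ C, y ≠ z.1 → L z.1 z.2 < L y z.2) :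
    ∃ z ∈ saddleSet C D L, Tendsto (fun t => (x t, lam t)) atTop (𝓝 z) := by
  obtain ⟨s, hs⟩ := hne
  have hanti : ∀ z ∈ saddleSet C D L, ∀ a b, 0 ≤ a → a ≤ b →
      ‖x b - z.1‖ ^ 2 + ‖lam b - z.2‖ ^ 2 ≤ ‖x a - z.1‖ ^ 2 + ‖lam a - z.2‖ ^ 2 :=
    fun z hz a b ha hab => h.norm_sq_add_norm_sq_le hC' hC.isClosed hCU hD' hD hz ha hab
  obtain ⟨R, hR⟩ : ∃ R, ∀ t, 0 ≤ t → ‖lam t‖ ≤ R := by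
    refine ⟨‖s.2‖ + √(‖x 0 - s.1‖ ^ 2 + ‖lam 0 - s.2‖ ^ 2), fun t ht => ?_⟩
    have h1 : ‖lam t - s.2‖ ≤ √(‖x 0 - s.1‖ ^ 2 + ‖lam 0 - s.2‖ ^ 2) :=
      Real.le_sqrt_of_sq_le ((le_add_of_nonneg_left (sq_nonneg _)).trans
        (hanti s hs 0 t le_rfl ht))
    linarith [norm_le_norm_add_norm_sub' (lam t) s.2]
  obtain ⟨B, hB0, hB⟩ := h.exists_lipschitz hC hU hCU hL hR
  have hK : IsCompact (C ×ˢ (D ∩ Metric.closedBall (0 : F) R)) :=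
    hC.prod ((isCompact_closedBall _ _).inter_left hD)
  have hKev : ∀ᶠ t in atTop, (x t, lam t) ∈ C ×ˢ (D ∩ Metric.closedBall (0 : F) R) := by
    filter_upwards [eventually_ge_atTop 0] with t ht
    exact ⟨h.mem_left hC.isClosed ht, h.mem_right hD ht, by simpa using hR t ht⟩
  have hcont : ∀ q : E × F, q.1 ∈ C → ContinuousAt (fun q : E × F => L q.1 q.2) q := fun q hq =>
    hL.continuousAt ((hU.prod isOpen_univ).mem_nhds ⟨hCU hq, mem_univ _⟩)
  have hcontl : ∀ (m : F) (q : E × F), q.1 ∈ C → ContinuousAt (fun q : E × F => L q.1 m) q :=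
    fun m q hq => ContinuousAt.comp (g := fun q : E × F => L q.1 q.2) (f := fun q : E × F => (q.1, m))
      (hcont (q.1, m) hq) (by fun_prop)
  have hcontr : ∀ (y : E) (q : E × F), y ∈ C → ContinuousAt (fun q : E × F => L y q.2) q :=
    fun y q hy => ContinuousAt.comp (g := fun q : E × F => L q.1 q.2) (f := fun q : E × F => (y, q.2))
      (hcont (y, q.2) hy) (by fun_prop)
  obtain ⟨l, hl⟩ : ∃ l, Tendsto (fun t => ‖x t - s.1‖ ^ 2 + ‖lam t - s.2‖ ^ 2) atTop (𝓝 l) := by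
    -- Freezing negative times at zero makes the function antitone on the whole line.
    have hA : Antitone fun t : ℝ =>
        ‖x (max t 0) - s.1‖ ^ 2 + ‖lam (max t 0) - s.2‖ ^ 2 := fun a b hab =>
      hanti s hs _ _ (le_max_right _ _) (max_le_max_right _ hab)
    refine ⟨_, (tendsto_atTop_ciInf hA ⟨0, ?_⟩).congr' ?_⟩
    · rintro _ ⟨t, rfl⟩
      positivity
    · filter_upwards [eventually_ge_atTop 0] with t ht
      rw [max_eq_left ht]
  -- The Lyapunov function is stationary at every limit point.
  have hW : ∀ q ∈ C ×ˢ (D ∩ Metric.closedBall (0 : F) R),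
      MapClusterPt q atTop (fun t => (x t, lam t)) → L q.1 s.2 - L s.1 q.2 ≤ 0 := by
    intro q hq hcl
    by_contra! hpos
    obtain ⟨η, hη0, hη⟩ := exists_between hpos
    have hO : {q : E × F | η < L q.1 s.2 - L s.1 q.2} ∈ 𝓝 q :=
      ((hcontl s.2 q hq.1).sub (hcontr s.1 q hs.1)).eventually (lt_mem_nhds hη)
    refine not_mapClusterPt_of_drop hB0 hB hl hO (η := 2 * η) (by positivity) ?_ hcl
    intro a b ha hab hmem
    exact h.drop hC' hC.isClosed hCU hD' hD hs.1 hs.2.1 ha hab fun t ht => (hmem t ht).le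
  -- The gap in `hW` is the sum of the two nonnegative saddle gaps at `s`, so both vanish; strict
  -- minimality then identifies the primal part.
  have hq1 : ∀ q ∈ C ×ˢ (D ∩ Metric.closedBall (0 : F) R),
      MapClusterPt q atTop (fun t => (x t, lam t)) → q.1 = s.1 ∧ L s.1 s.2 ≤ L s.1 q.2 := by
    intro q hq hcl
    have h1 := hW q hq hcl
    have h2 := hs.2.2.1 _ hq.2.1
    have h3 := hs.2.2.2 _ hq.1
    refine ⟨?_, by linarith⟩
    by_contra hne
    have := hstrict s hs _ hq.1 hne
    linarith
  obtain ⟨q, hq, hcl⟩ := hK.exists_mapClusterPt (f := atTop) (u := fun t => (x t, lam t))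
    (by simpa using hKev)
  have hx : Tendsto x atTop (𝓝 s.1) := by
    refine hC.tendsto_nhds_of_unique_mapClusterPt
      (hKev.mono fun t ht => ht.1) fun y hy hycl => ?_
    -- Compactness along an ultrafilter lifts a cluster point of `x` to one of the pair.
    obtain ⟨U', hU', hUy⟩ := mapClusterPt_iff_ultrafilter.1 hycl
    obtain ⟨q', hq', hqlim⟩ := hK.ultrafilter_le_nhds (U'.map fun t => (x t, lam t))
      (le_principal_iff.2 (hU' hKev))
    have hlim : Tendsto (fun t => (x t, lam t)) U' (𝓝 q') := hqlim
    have h1 := (hq1 q' hq' (mapClusterPt_iff_ultrafilter.2 ⟨U', hU', hlim⟩)).1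
    rw [← h1]
    exact tendsto_nhds_unique hUy ((continuous_fst.tendsto q').comp hlim)
  obtain ⟨hqs, hqL⟩ := hq1 q hq hcl
  have hsad : q ∈ saddleSet C D L := by
    refine ⟨hq.1, hq.2.1, fun m hm => ?_, fun y hy => ?_⟩
    · rw [hqs]
      exact (hs.2.2.1 m hm).trans hqL
    · by_contra! hlt
      obtain ⟨η, hη0, hη⟩ := exists_between (sub_pos.2 hlt)
      have hO : {q : E × F | η < L q.1 q.2 - L y q.2} ∈ 𝓝 q :=
        ((hcont q hq.1).sub (hcontr y q hy)).eventually (lt_mem_nhds hη)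
      -- Since `x` already converges, this primal distance converges for every `y`, so it cannot
      -- keep falling near `q`.
      have hlim : Tendsto (fun t => ‖x t - y‖ ^ 2) atTop (𝓝 (‖s.1 - y‖ ^ 2)) :=
        (hx.sub_const y).norm.pow 2
      refine not_mapClusterPt_of_drop hB0 hB hlim hO (η := 2 * η) (by positivity) ?_ hcl
      intro a b ha hab hmem
      exact h.drop_left hC' hC.isClosed hCU hy ha hab fun t ht => (hmem t ht).le
  refine ⟨q, hsad, Metric.tendsto_nhds.2 fun ε hε => ?_⟩
  -- The trajectory enters a small ball around the saddle point `q`, and stability keeps it close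
  -- from then on.
  have hfr := mapClusterPt_iff_frequently.1 hcl _ (Metric.ball_mem_nhds q (half_pos hε))
  obtain ⟨a, ha, ha0⟩ := (hfr.and_eventually (eventually_ge_atTop 0)).exists
  filter_upwards [eventually_ge_atTop a] with t hat
  exact h.dist_lt_of_dist_lt hC' hC.isClosed hCU hD' hD hsad hε ha0 hat ha

end IsSaddleFlow

end SaddleFlow

/-! ### Oscillation of functions on a connected graph -/

section Graph

variable {V : Type*} {G : SimpleGraph V}

open Classical in
-- The differences telescope along the walk. Positive parts make every term nonnegative while
-- keeping the orientation of the edge.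
theorem sub_le_sum_map_darts_max (u : V → ℝ) {a b : V} (w : G.Walk a b) :
    u a - u b ≤ (w.darts.map fun d => max (u d.fst - u d.snd) 0).sum := by
  induction w with
  | nil => simp
  | cons h w ih =>
    rw [SimpleGraph.Walk.darts_cons, List.map_cons, List.sum_cons]
    refine le_trans ?_ (add_le_add (le_max_left _ _) ih)
    linarith

open Classical in
/-- In a connected graph, the oscillation of a function on the vertices is at most the sum of
its oscillations along the edges. -/
theorem abs_sub_le_half_sum_neighborFinset [Fintype V] (hG : G.Connected) (u : V → ℝ) (a b : V) :
    |u a - u b| ≤ (1 / 2) * ∑ i, ∑ j ∈ G.neighborFinset i, |u i - u j| := by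
  have hsum : ∀ h : V → V → ℝ, ∑ i, ∑ j ∈ G.neighborFinset i, h i j =
      ∑ q : V × V with G.Adj q.1 q.2, h q.1 q.2 := by
    intro h
    rw [Finset.sum_filter, Fintype.sum_prod_type]
    refine Finset.sum_congr rfl fun i _ => ?_
    rw [← Finset.sum_filter]
    refine Finset.sum_congr ?_ fun _ _ => rfl
    ext j
    simp
  have hswap : ∑ q : V × V with G.Adj q.1 q.2, max (u q.2 - u q.1) 0 =
      ∑ q : V × V with G.Adj q.1 q.2, max (u q.1 - u q.2) 0 := by
    refine Finset.sum_equiv (Equiv.prodComm V V) ?_ ?_ <;> simp [SimpleGraph.adj_comm]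
  -- Replacing absolute values by positive parts over ordered pairs uses up the factor `1 / 2`. A
  -- path has distinct darts, so its sum is part of this total.
  have habs : (1 / 2) * ∑ i, ∑ j ∈ G.neighborFinset i, |u i - u j| =
      ∑ q : V × V with G.Adj q.1 q.2, max (u q.1 - u q.2) 0 := by
    have h1 : ∀ q : V × V, |u q.1 - u q.2| = max (u q.1 - u q.2) 0 + max (u q.2 - u q.1) 0 := by
      intro q
      rcases le_total (u q.1) (u q.2) with h | h
      · rw [abs_of_nonpos (by linarith), max_eq_right (by linarith), max_eq_left (by linarith)]
        ring
      · rw [abs_of_nonneg (by linarith), max_eq_left (by linarith), max_eq_right (by linarith)]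
        ring
    rw [hsum]
    simp_rw [h1]
    rw [Finset.sum_add_distrib, hswap]
    ring
  have hle : ∀ a b, u a - u b ≤ ∑ q : V × V with G.Adj q.1 q.2, max (u q.1 - u q.2) 0 := by
    intro a b
    obtain ⟨w, hw⟩ := (hG.preconnected a b).exists_isPath
    refine (sub_le_sum_map_darts_max u w).trans ?_
    have hnd : (w.darts.map fun d => d.toProd).Nodup :=
      (SimpleGraph.Walk.darts_nodup_of_support_nodup hw.support_nodup).map
        (fun d e h => SimpleGraph.Dart.ext d e h)
    have h1 : (w.darts.map fun d => max (u d.fst - u d.snd) 0).sum =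
        ∑ q ∈ (w.darts.map fun d => d.toProd).toFinset, max (u q.1 - u q.2) 0 := by
      rw [List.sum_toFinset _ hnd, List.map_map]
      rfl
    rw [h1]
    refine Finset.sum_le_sum_of_subset_of_nonneg (fun q hq => ?_) fun _ _ _ => le_max_right _ _
    obtain ⟨d, -, rfl⟩ := List.mem_map.1 (List.mem_toFinset.1 hq)
    simp
  rw [habs, abs_le]
  constructor
  · linarith [hle b a]
  · exact hle a b

end Graph

/-! ### Stacked vectors and the nonnegative orthant -/

section Block

variable {N M : ℕ} {n : Fin N → ℕ}

theorem continuous_block (i : Fin N) : Continuous fun x : Primal n => block x i := by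
  unfold block
  fun_prop

theorem block_add_smul (a b : ℝ) (x y : Primal n) (i : Fin N) :
    block (a • x + b • y) i = a • block x i + b • block y i := by
  ext j
  simp [block]

theorem exists_block_ne {x y : Primal n} (h : x ≠ y) : ∃ i, block x i ≠ block y i := by
  by_contra! hne
  refine h (PiLp.ext fun s => ?_)
  have := congrArg (fun v : EuclideanSpace ℝ (Fin (n s.1)) => v s.2) (hne s.1)
  simpa [block] using this

theorem isClosed_orthant (N M : ℕ) : IsClosed (orthant N M) := by
  have : orthant N M = ⋂ i, ⋂ k, {lam : Dual N M | 0 ≤ lam (i, k)} := by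
    ext lam
    simp [orthant]
  rw [this]
  exact isClosed_iInter fun i => isClosed_iInter fun k =>
    isClosed_le continuous_const (by fun_prop)

theorem convex_orthant (N M : ℕ) : Convex ℝ (orthant N M) := by
  intro x hx y hy a b ha hb _ i k
  have := mul_nonneg ha (hx i k)
  have := mul_nonneg hb (hy i k)
  simp only [PiLp.add_apply, PiLp.smul_apply, smul_eq_mul]
  linarith

end Block

/-! ### The consensus penalty and the disagreement of the multipliers -/

namespace Problem

variable {N M : ℕ} {n : Fin N → ℕ} {p : Problem N M n}

theorem phi_nonneg (lam : Dual N M) : 0 ≤ p.phi lam := by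
  unfold phi
  positivity

theorem phi_add_smul_le {a b : ℝ} (ha : 0 ≤ a) (hb : 0 ≤ b) (x y : Dual N M) :
    p.phi (a • x + b • y) ≤ a * p.phi x + b * p.phi y := by
  classical
  have h : a * p.phi x + b * p.phi y = (1 / 2) * ∑ i, ∑ j ∈ p.G.neighborFinset i, ∑ k,
      (a * |x (i, k) - x (j, k)| + b * |y (i, k) - y (j, k)|) := by
    simp only [phi, Finset.sum_add_distrib, ← Finset.mul_sum]
    ring_nf
  rw [h, phi]
  refine mul_le_mul_of_nonneg_left ?_ (by norm_num)
  refine Finset.sum_le_sum fun i _ => ?_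
  have : ∀ j, ∑ k, |(a • x + b • y) (i, k) - (a • x + b • y) (j, k)| ≤
      ∑ k, (a * |x (i, k) - x (j, k)| + b * |y (i, k) - y (j, k)|) := by
    intro j
    refine Finset.sum_le_sum fun k _ => ?_
    simp only [PiLp.add_apply, PiLp.smul_apply, smul_eq_mul]
    rw [← abs_of_nonneg ha, ← abs_of_nonneg hb, ← abs_mul, ← abs_mul, abs_of_nonneg ha,
      abs_of_nonneg hb]
    refine le_trans (le_of_eq (congrArg _ ?_)) (abs_add_le _ _)
    ring
  convert! Finset.sum_le_sum fun j (_ : j ∈ p.G.neighborFinset i) => this j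

theorem continuous_phi : Continuous p.phi := by
  unfold phi
  fun_prop

open Classical in
theorem phi_eq_sum (lam : Dual N M) : p.phi lam = ∑ k, (1 / 2) * ∑ i,
    ∑ j ∈ p.G.neighborFinset i, |lam (i, k) - lam (j, k)| := by
  rw [← Finset.mul_sum, Finset.sum_comm, phi]
  congr 1
  exact Finset.sum_congr rfl fun i _ => Finset.sum_comm

/-- The average over the agents of the `k`-th components of the local multipliers. -/
noncomputable def avg (lam : Dual N M) (k : Fin M) : ℝ := (∑ i, lam (i, k)) / N

theorem avg_nonneg {lam : Dual N M} (hlam : lam ∈ orthant N M) (k : Fin M) : 0 ≤ avg lam k :=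
  div_nonneg (Finset.sum_nonneg fun i _ => hlam i k) (Nat.cast_nonneg N)

theorem le_mul_avg {lam : Dual N M} (hlam : lam ∈ orthant N M) (i : Fin N) (k : Fin M) :
    lam (i, k) ≤ N * avg lam k := by
  have : (N : ℝ) ≠ 0 := Nat.cast_ne_zero.2 (Fin.pos i).ne'
  rw [avg, mul_div_cancel₀ _ this]
  exact Finset.single_le_sum (f := fun i => lam (i, k)) (fun j _ => hlam j k) (Finset.mem_univ i)

/-- The deviation of the local multipliers from their average. -/
noncomputable def deviation (lam : Dual N M) : Dual N M :=
  WithLp.toLp 2 fun ik => lam ik - avg lam ik.2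

open Classical in
-- The deviation is the mean over `j` of `lam (i, k) - lam (j, k)`, and each such difference is
-- bounded by the edge sum.
theorem abs_deviation_le (hG : p.G.Connected) (lam : Dual N M) (i : Fin N) (k : Fin M) :
    |deviation lam (i, k)| ≤
      (1 / 2) * ∑ i, ∑ j ∈ p.G.neighborFinset i, |lam (i, k) - lam (j, k)| := by
  have hN : (0 : ℝ) < N := Nat.cast_pos.2 (Fin.pos i)
  have h1 : deviation lam (i, k) = (∑ j, (lam (i, k) - lam (j, k))) / N := by
    simp only [deviation, avg, Finset.sum_sub_distrib, Finset.sum_const, Finset.card_univ,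
      Fintype.card_fin, nsmul_eq_mul]
    field_simp
  rw [h1, abs_div, abs_of_pos hN, div_le_iff₀ hN]
  refine (Finset.abs_sum_le_sum_abs _ _).trans ?_
  refine (Finset.sum_le_sum fun j _ =>
    abs_sub_le_half_sum_neighborFinset hG (fun i => lam (i, k)) i j).trans ?_
  rw [Finset.sum_const, Finset.card_univ, Fintype.card_fin, nsmul_eq_mul, mul_comm]

/-- For each agent the components of the deviation are bounded by the summands of `phi`, so their
squares sum to at most `phi ^ 2`. Summing over the `N` agents gives the factor `√N` in the threshold
for `K`. -/
theorem norm_deviation_le (hG : p.G.Connected) (lam : Dual N M) :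
    ‖deviation lam‖ ≤ √N * p.phi lam := by
  classical
  refine le_of_sq_le_sq ?_ (mul_nonneg (Real.sqrt_nonneg _) (phi_nonneg lam))
  rw [EuclideanSpace.norm_sq_eq, mul_pow, Real.sq_sqrt (Nat.cast_nonneg N),
    Fintype.sum_prod_type, phi_eq_sum]
  calc ∑ i, ∑ k, ‖deviation lam (i, k)‖ ^ 2
      ≤ ∑ _i : Fin N, (∑ k, (1 / 2) * ∑ i, ∑ j ∈ p.G.neighborFinset i,
          |lam (i, k) - lam (j, k)|) ^ 2 := by
        refine Finset.sum_le_sum fun i _ => ?_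
        refine le_trans (Finset.sum_le_sum fun k _ => ?_)
          (Finset.sum_sq_le_sq_sum_of_nonneg (fun _ _ => by positivity))
        exact pow_le_pow_left₀ (norm_nonneg _) (abs_deviation_le hG lam i k) 2
    _ = _ := by simp

/-- Splits the multiplier into average and deviation and applies Cauchy–Schwarz to the latter. -/
theorem sum_mul_le (hG : p.G.Connected) (lam gs : Dual N M) :
    ∑ i, ∑ k, lam (i, k) * gs (i, k) ≤
      ∑ k, avg lam k * ∑ i, gs (i, k) + √N * ‖gs‖ * p.phi lam := by
  have h1 : ∑ i, ∑ k, lam (i, k) * gs (i, k) =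
      ∑ k, avg lam k * ∑ i, gs (i, k) + inner ℝ (deviation lam) gs := by
    rw [PiLp.inner_apply, Fintype.sum_prod_type]
    simp_rw [Finset.mul_sum]
    rw [Finset.sum_comm (s := (Finset.univ : Finset (Fin M))), ← Finset.sum_add_distrib]
    refine Finset.sum_congr rfl fun i _ => ?_
    rw [← Finset.sum_add_distrib]
    refine Finset.sum_congr rfl fun k _ => ?_
    simp [deviation]
    ring
  have h2 := real_inner_le_norm (deviation lam) gs
  have h3 := mul_le_mul_of_nonneg_right (norm_deviation_le hG lam) (norm_nonneg gs)
  rw [h1]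
  linarith

/-! ### Convexity and continuity of the modified Lagrangian -/

theorem convex_localSet (hp : p.Assumption) : Convex ℝ p.localSet := by
  intro x hx y hy a b ha hb hab i
  rw [block_add_smul]
  exact hp.convex i (hx i) (hy i) ha hb hab

theorem convex_domain (hp : p.Assumption) : Convex ℝ p.domain := by
  intro x hx y hy a b ha hb hab i
  rw [block_add_smul]
  exact (hp.strictConvexOn_f i).1 (hx i) (hy i) ha hb hab

theorem localSet_subset_domain (hp : p.Assumption) : p.localSet ⊆ p.domain :=
  fun _ hx i => hp.subset_domain i (hx i)

theorem isOpen_domain (hp : p.Assumption) : IsOpen p.domain := by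
  have : p.domain = ⋂ i, (fun x => block x i) ⁻¹' p.U i := by
    ext x
    simp [domain]
  rw [this]
  exact isOpen_iInter_of_finite fun i => (hp.isOpen_domain i).preimage (continuous_block i)

theorem isCompact_localSet (hp : p.Assumption) : IsCompact p.localSet := by
  have h := (isCompact_univ_pi hp.isCompact).image
    (f := fun y => (WithLp.toLp 2 fun s => y s.1 s.2 : Primal n)) (by fun_prop)
  convert! h using 1
  ext x
  constructor
  · exact fun hx => ⟨fun i => block x i, fun i _ => hx i, rfl⟩
  · rintro ⟨y, hy, rfl⟩ i
    exact hy i (mem_univ i)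

theorem strictConvexOn_modLagrangian (hp : p.Assumption) (K : ℝ) {lam : Dual N M}
    (hlam : lam ∈ orthant N M) :
    StrictConvexOn ℝ p.domain fun x => p.modLagrangian K x lam := by
  refine ⟨convex_domain hp, fun x hx y hy hxy a b ha hb hab => ?_⟩
  -- One differing block suffices: strictness comes from `f` at `i₀`, while nonnegative multipliers
  -- keep the constraint terms convex.
  obtain ⟨i₀, hi₀⟩ := exists_block_ne hxy
  have hg : ∀ i, ∑ k, lam (i, k) * p.g i (a • block x i + b • block y i) k ≤
      a * ∑ k, lam (i, k) * p.g i (block x i) k + b * ∑ k, lam (i, k) * p.g i (block y i) k := by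
    intro i
    rw [Finset.mul_sum, Finset.mul_sum, ← Finset.sum_add_distrib]
    refine Finset.sum_le_sum fun k _ => ?_
    have := mul_le_mul_of_nonneg_left
      ((hp.convexOn_g i k).2 (hx i) (hy i) ha.le hb.le hab) (hlam i k)
    simp only [smul_eq_mul] at this
    linarith
  have key : ∑ i, (p.f i (a • block x i + b • block y i) +
        ∑ k, lam (i, k) * p.g i (a • block x i + b • block y i) k) <
      ∑ i, (a * (p.f i (block x i) + ∑ k, lam (i, k) * p.g i (block x i) k) +
        b * (p.f i (block y i) + ∑ k, lam (i, k) * p.g i (block y i) k)) := by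
    refine Finset.sum_lt_sum (fun i _ => ?_) ⟨i₀, Finset.mem_univ _, ?_⟩
    · have := (hp.strictConvexOn_f i).convexOn.2 (hx i) (hy i) ha.le hb.le hab
      simp only [smul_eq_mul] at this
      linarith [hg i]
    · have := (hp.strictConvexOn_f i₀).2 (hx i₀) (hy i₀) hi₀ ha hb hab
      simp only [smul_eq_mul] at this
      linarith [hg i₀]
  rw [Finset.sum_add_distrib (f := fun i => a * _), ← Finset.mul_sum, ← Finset.mul_sum] at key
  simp only [modLagrangian, block_add_smul, smul_eq_mul]
  have h1 : K * p.phi lam = a * (K * p.phi lam) + b * (K * p.phi lam) := by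
    rw [← add_mul, hab, one_mul]
  linarith

theorem concaveOn_modLagrangian {K : ℝ} (hK : 0 ≤ K) (x : Primal n) :
    ConcaveOn ℝ univ fun lam => p.modLagrangian K x lam := by
  refine ⟨convex_univ, fun l _ m _ a b ha hb hab => ?_⟩
  have h1 := mul_le_mul_of_nonneg_left (phi_add_smul_le (p := p) ha hb l m) hK
  have h2 : ∑ i, (p.f i (block x i) + ∑ k, (a • l + b • m) (i, k) * p.g i (block x i) k) =
      a * ∑ i, (p.f i (block x i) + ∑ k, l (i, k) * p.g i (block x i) k) +
      b * ∑ i, (p.f i (block x i) + ∑ k, m (i, k) * p.g i (block x i) k) := by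
    rw [Finset.mul_sum, Finset.mul_sum, ← Finset.sum_add_distrib]
    refine Finset.sum_congr rfl fun i _ => ?_
    have h3 : p.f i (block x i) = a * p.f i (block x i) + b * p.f i (block x i) := by
      rw [← add_mul, hab, one_mul]
    rw [mul_add, mul_add, Finset.mul_sum, Finset.mul_sum, add_add_add_comm, ← h3,
      ← Finset.sum_add_distrib]
    refine congrArg _ (Finset.sum_congr rfl fun k _ => ?_)
    simp only [PiLp.add_apply, PiLp.smul_apply, smul_eq_mul]
    ring
  simp only [modLagrangian, smul_eq_mul]
  rw [h2]
  linarith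

theorem continuousOn_modLagrangian (hp : p.Assumption) (K : ℝ) :
    ContinuousOn (fun q : Primal n × Dual N M => p.modLagrangian K q.1 q.2)
      (p.domain ×ˢ univ) := by
  have hb : ∀ i, ContinuousOn (fun q : Primal n × Dual N M => block q.1 i) (p.domain ×ˢ univ) :=
    fun i => ((continuous_block i).comp continuous_fst).continuousOn
  have hm : ∀ i, MapsTo (fun q : Primal n × Dual N M => block q.1 i) (p.domain ×ˢ univ) (p.U i) :=
    fun i q hq => hq.1 i
  have hf := fun i => (hp.locallyLipschitzOn_f i).continuousOn.comp (hb i) (hm i)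
  have hg := fun i => (hp.locallyLipschitzOn_g i).continuousOn.comp (hb i) (hm i)
  unfold modLagrangian
  refine ContinuousOn.sub (continuousOn_finsetSum _ fun i _ => (hf i).add
    (continuousOn_finsetSum _ fun k _ => ContinuousOn.mul (by fun_prop) ?_))
    (continuousOn_const.mul (continuous_phi.comp continuous_snd).continuousOn)
  exact ((EuclideanSpace.proj (𝕜 := ℝ) k).continuous.comp_continuousOn (hg i))

theorem continuousOn_modLagrangian_left (hp : p.Assumption) (K : ℝ) (lam : Dual N M) :
    ContinuousOn (fun x => p.modLagrangian K x lam) p.domain :=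
  (continuousOn_modLagrangian hp K).comp (f := fun x => (x, lam)) (by fun_prop)
    fun x hx => ⟨hx, mem_univ _⟩

theorem continuous_modLagrangian_right (K : ℝ) (x : Primal n) :
    Continuous fun lam => p.modLagrangian K x lam := by
  have := continuous_phi (p := p)
  unfold modLagrangian
  fun_prop

/-! ### Exact penalty, saddle points and equilibria -/

/-- The penalty outweighs the contribution of the disagreement, so only the average multiplier acts,
and it acts on the summed constraint, to which Slater's condition applies. -/
theorem modLagrangian_le (hp : p.Assumption) {K : ℝ} {x : Primal n} {lam : Dual N M}
    (hK : √N * ‖p.gStack x‖ ≤ K) :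
    p.modLagrangian K x lam ≤
      p.modLagrangian K x 0 + ∑ k, avg lam k * ∑ i, p.g i (block x i) k := by
  have h1 := sum_mul_le hp.connected lam (p.gStack x)
  have h2 := mul_le_mul_of_nonneg_right hK (phi_nonneg (p := p) lam)
  have h3 : p.phi 0 = 0 := by simp [phi]
  simp only [gStack] at h1
  simp only [modLagrangian, Finset.sum_add_distrib, h3]
  simp only [gStack] at h2
  simp
  linarith

/-- Slater's condition yields a saddle point of the modified Lagrangian. -/
theorem saddlePoints_nonempty (hp : p.Assumption) {K : ℝ}
    (hK : ∀ x ∈ p.localSet, √N * ‖p.gStack x‖ ≤ K) : (p.saddlePoints K).Nonempty := by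
  obtain ⟨y, hy, hslater⟩ := hp.slater
  have hyΩ : y ∈ p.localSet := intrinsicInterior_subset hy
  have hK0 : 0 ≤ K := le_trans (by positivity) (hK y hyΩ)
  have hcont : ∀ lam, ContinuousOn (fun x => p.modLagrangian K x lam) p.localSet :=
    fun lam => (continuousOn_modLagrangian_left hp K lam).mono (localSet_subset_domain hp)
  obtain ⟨x₀, hx₀, hmin⟩ := (isCompact_localSet hp).exists_isMinOn ⟨y, hyΩ⟩ (hcont 0)
  set Δ := p.modLagrangian K y 0 - p.modLagrangian K x₀ 0 with hΔ
  have hΔ0 : 0 ≤ Δ := sub_nonneg.2 (hmin hyΩ)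
  -- Slater's point bounds each component of a saddle multiplier by one of these summands; the extra
  -- `1` makes the bound by `R` strict.
  set R : ℝ := 1 + ∑ k, N * (Δ / -∑ i, p.g i (block y i) k) with hR
  have hterm : ∀ k, 0 ≤ N * (Δ / -∑ i, p.g i (block y i) k) := fun k =>
    mul_nonneg (Nat.cast_nonneg N) (div_nonneg hΔ0 (by linarith [hslater k]))
  have hR0 : 0 ≤ R := add_nonneg zero_le_one (Finset.sum_nonneg fun k _ => hterm k)
  set Y : Set (Dual N M) := {lam | ∀ ik, lam ik ∈ Icc 0 R} with hY
  have hYo : Y ⊆ orthant N M := fun lam h i k => (h (i, k)).1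
  have hYc : IsCompact Y := by
    have h := (isCompact_univ_pi fun _ : Fin N × Fin M => isCompact_Icc (a := (0 : ℝ)) (b := R)).image
      (f := fun v => (WithLp.toLp 2 v : Dual N M)) (by fun_prop)
    convert! h using 1
    ext lam
    constructor
    · exact fun hl => ⟨fun ik => lam ik, fun ik _ => hl ik, rfl⟩
    · rintro ⟨v, hv, rfl⟩ ik
      exact hv ik (mem_univ ik)
  have hYconv : Convex ℝ Y := fun l hl m hm a b ha hb hab ik =>
    convex_Icc 0 R (hl ik) (hm ik) ha hb hab
  have hY0 : (0 : Dual N M) ∈ Y := fun ik => ⟨le_rfl, hR0⟩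
  obtain ⟨x, hx, lam, hlam, hsad⟩ := Sion.exists_isSaddlePointOn (f := p.modLagrangian K)
    ⟨y, hyΩ⟩ (convex_localSet hp) (isCompact_localSet hp)
    (fun l _ => (hcont l).lowerSemicontinuousOn)
    (fun l hl => ((strictConvexOn_modLagrangian hp K (hYo hl)).convexOn.subset
      (localSet_subset_domain hp) (convex_localSet hp)).quasiconvexOn)
    hYconv ⟨0, hY0⟩ hYc
    (fun x _ => (continuous_modLagrangian_right K x).continuousOn.upperSemicontinuousOn)
    (fun x _ => ((concaveOn_modLagrangian hK0 x).subset (subset_univ _) hYconv).quasiconcaveOn)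
  -- The saddle inequality is tested with the Slater point `y` against the zero multiplier.
  have hbound : ∑ k, avg lam k * -∑ i, p.g i (block y i) k ≤ Δ := by
    have h1 := hsad y hyΩ 0 hY0
    have h2 := modLagrangian_le hp (lam := lam) (hK y hyΩ)
    have h3 : p.modLagrangian K x₀ 0 ≤ p.modLagrangian K x 0 := hmin hx
    simp only [mul_neg, Finset.sum_neg_distrib]
    linarith
  have hlt : ∀ ik, lam ik < R := by
    rintro ⟨i, k⟩
    have hk : 0 < -∑ i, p.g i (block y i) k := by linarith [hslater k]
    have h1 : avg lam k * -∑ i, p.g i (block y i) k ≤ Δ :=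
      (Finset.single_le_sum (f := fun k => avg lam k * -∑ i, p.g i (block y i) k)
        (fun k _ => mul_nonneg (avg_nonneg (hYo hlam) k) (by linarith [hslater k]))
        (Finset.mem_univ k)).trans hbound
    have h2 : avg lam k ≤ Δ / -∑ i, p.g i (block y i) k := (le_div_iff₀ hk).2 h1
    have h3 := Finset.single_le_sum (f := fun k => N * (Δ / -∑ i, p.g i (block y i) k))
      (fun k _ => hterm k) (Finset.mem_univ k)
    have h4 := le_mul_avg (hYo hlam) i k
    have h5 := mul_le_mul_of_nonneg_left h2 (Nat.cast_nonneg (α := ℝ) N)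
    simp only at h3
    linarith
  refine ⟨(x, lam), hx, hYo hlam, ?_, fun z hz => hsad z hz lam hlam⟩
  -- The multiplier misses the upper faces of the box, so near it the orthant and the box agree;
  -- concavity makes the local maximum global.
  have hloc : IsLocalMaxOn (fun l => p.modLagrangian K x l) (orthant N M) lam := by
    have h1 : ∀ᶠ l in 𝓝 lam, ∀ ik, l ik < R := by
      refine eventually_all.2 fun ik => ?_
      exact (Continuous.tendsto (f := fun l : Dual N M => l ik) (by fun_prop) lam).eventually
        (gt_mem_nhds (hlt ik))
    filter_upwards [mem_nhdsWithin_of_mem_nhds h1, self_mem_nhdsWithin] with l hl hlo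
    exact hsad x hx l fun ik => ⟨hlo ik.1 ik.2, (hl ik).le⟩
  exact fun l hl => IsMaxOn.of_isLocalMaxOn_of_concaveOn (hYo hlam) hloc
    ((concaveOn_modLagrangian hK0 x).subset (subset_univ _) (convex_orthant N M)) hl

theorem saddlePoints_subset_equilibria (hp : p.Assumption) {K : ℝ} (hK : 0 ≤ K) :
    p.saddlePoints K ⊆ p.equilibria K := by
  rintro ⟨x, lam⟩ ⟨hx, hlam, hmax, hmin⟩
  constructor
  · exact zero_mem_projTangent_neg_subdifferential (convex_localSet hp)
      (localSet_subset_domain hp) (isOpen_domain hp)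
      (strictConvexOn_modLagrangian hp K hlam).convexOn
      (continuousOn_modLagrangian_left hp K lam) hx hmin
  · exact zero_mem_projTangent_neg_subdifferential (convex_orthant N M) (subset_univ _)
      isOpen_univ (concaveOn_modLagrangian hK x).neg
      (continuous_modLagrangian_right K x).neg.continuousOn hlam
      fun l hl => neg_le_neg (hmax l hl)

theorem equilibria_subset_saddlePoints (hp : p.Assumption) (K : ℝ) :
    p.equilibria K ⊆ p.saddlePoints K := by
  rintro ⟨x, lam⟩ ⟨hx, hlam⟩
  have hC := (isCompact_localSet hp).isClosed
  refine ⟨mem_of_mem_projTangent hC hx, mem_of_mem_projTangent (isClosed_orthant N M) hlam,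
    fun l hl => ?_, fun y hy => ?_⟩
  · have := inner_le_of_mem_projTangent_neg_subdifferential (convex_orthant N M)
      (isClosed_orthant N M) (subset_univ _) hlam hl
    rw [inner_zero_right] at this
    simp only at this ⊢
    linarith
  · have := inner_le_of_mem_projTangent_neg_subdifferential (convex_localSet hp) hC
      (localSet_subset_domain hp) hx hy
    rw [inner_zero_right] at this
    exact sub_nonneg.1 this

theorem IsSolution.isSaddleFlow {K : ℝ} {x : ℝ → Primal n} {lam : ℝ → Dual N M}
    (h : p.IsSolution K x lam) :
    IsSaddleFlow p.localSet p.domain (orthant N M) (p.modLagrangian K) x lam :=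
  ⟨h.absCont_x, h.absCont_lam, h.init_x, h.init_lam, h.inclusion_x, h.inclusion_lam⟩

theorem modLagrangian_lt_of_mem_saddlePoints (hp : p.Assumption) {K : ℝ}
    {z : Primal n × Dual N M} (hz : z ∈ p.saddlePoints K) {y : Primal n} (hy : y ∈ p.localSet)
    (hne : y ≠ z.1) : p.modLagrangian K z.1 z.2 < p.modLagrangian K y z.2 := by
  obtain ⟨hz1, hz2, -, hmin⟩ := hz
  refine lt_of_le_of_ne (hmin y hy) fun heq => hne ?_
  exact ((strictConvexOn_modLagrangian hp K hz2).subset (localSet_subset_domain hp)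
    (convex_localSet hp)).eq_of_isMinOn (fun w hw => heq.symm.le.trans (hmin w hw)) hmin hy hz1

end Problem

end DistOpt

/-! ### Stability and convergence of the algorithm -/

theorem theorem3 {N M : ℕ} {n : Fin N → ℕ} (p : DistOpt.Problem N M n) (hp : p.Assumption)
    (K₀ K : ℝ) (hK₀ : IsGreatest ((fun x => ‖p.gStack x‖) '' p.localSet) K₀)
    (hK : √N * K₀ < K) :
    p.Stable K ∧
    ∀ (x : ℝ → DistOpt.Primal n) (lam : ℝ → DistOpt.Dual N M), p.IsSolution K x lam →
      Tendsto (fun t => Metric.infDist (x t, lam t) (p.saddlePoints K)) atTop (𝓝 0) ∧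
      ∃ z ∈ p.saddlePoints K, Tendsto (fun t => (x t, lam t)) atTop (𝓝 z) := by
  have hK' : ∀ x ∈ p.localSet, √N * ‖p.gStack x‖ ≤ K := fun x hx =>
    (mul_le_mul_of_nonneg_left (hK₀.2 ⟨x, hx, rfl⟩) (Real.sqrt_nonneg _)).trans hK.le
  have hne := DistOpt.Problem.saddlePoints_nonempty hp hK'
  have hK0 : 0 ≤ K := by
    obtain ⟨z, hz⟩ := hne
    exact le_trans (by positivity) (hK' z.1 hz.1)
  have hC := DistOpt.Problem.convex_localSet hp
  have hCc := DistOpt.Problem.isCompact_localSet hp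
  have hCU := DistOpt.Problem.localSet_subset_domain hp
  have hD := DistOpt.convex_orthant N M
  have hD' := DistOpt.isClosed_orthant N M
  refine ⟨⟨hne.mono (DistOpt.Problem.saddlePoints_subset_equilibria hp hK0), ?_⟩, ?_⟩
  · intro z hz ε hε
    refine ⟨ε / 2, half_pos hε, fun x lam hsol hdist t ht => ?_⟩
    exact hsol.isSaddleFlow.dist_lt_of_dist_lt hC hCc.isClosed hCU hD hD'
      (DistOpt.Problem.equilibria_subset_saddlePoints hp K hz) hε le_rfl ht hdist
  · intro x lam hsol
    obtain ⟨z, hz, hlim⟩ := hsol.isSaddleFlow.exists_tendsto_saddle hCc hC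
      (DistOpt.Problem.isOpen_domain hp) hCU hD' hD
      (DistOpt.Problem.continuousOn_modLagrangian hp K) hne
      fun z hz y hy hyz => DistOpt.Problem.modLagrangian_lt_of_mem_saddlePoints hp hz hy hyz
    refine ⟨?_, z, hz, hlim⟩
    exact squeeze_zero (fun _ => Metric.infDist_nonneg)
      (fun _ => Metric.infDist_le_dist_of_mem hz) (tendsto_iff_dist_tendsto_zero.1 hlim)
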